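/- Let $R$ be an associative ring with identity. A right $R$-module $M$ is said to have finite Goldie dimension if, for some integer $n\ge 0$, some essential submodule of $M$ is a direct sum of $n$ uniform submodules (a module is uniform if it is nonzero and all its nonzero submodules are essential in it). The ring $R$ is called right finite dimensional if the right module $R_R$ has finite Goldie dimension; right self-injective if $R_R$ is an injective right $R$-module; semilocal if $R/J(R)$ is a semisimple ring, where $J(R)$ is the Jacobson radical; and $R$ is said to have an essential right socle if the socle of $R_R$ (the sum of all simple right ideals) is an essential submodule of $R_R$. The ring $R$ is called right PF if it is semilocal and right self-injective with an essential right socle. Then $R$ is right PF if and only if $R$ is right finite dimensional, right self-injective, and has an essential right socle. -/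

import Mathlib

section ModuleNotions

variable (S : Type*) [Ring S] (M : Type*) [AddCommGroup M] [Module S M]

/-- `N` is an essential submodule of `M`: the only submodule of `M` that meets `N` trivially
is zero. -/
def IsEssentialSubmodule {S : Type*} [Ring S] {M : Type*} [AddCommGroup M] [Module S M]
    (N : Submodule S M) : Prop :=
  ∀ K : Submodule S M, N ⊓ K = ⊥ → K = ⊥

/-- `M` is a uniform module: it is nonzero and each of its nonzero submodules is essential. -/
def IsUniformModule : Prop :=
  Nontrivial M ∧ ∀ N : Submodule S M, N ≠ ⊥ → IsEssentialSubmodule N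

/-- `G.dim M = n`: some essential submodule of `M` is the (internal) direct sum of `n` uniform
submodules. -/
def HasGoldieDim (n : ℕ) : Prop :=
  ∃ U : Fin n → Submodule S M,
    (∀ i, IsUniformModule S (U i)) ∧ iSupIndep U ∧ IsEssentialSubmodule (⨆ i, U i)

/-- `G.dim M < +∞`, that is, `G.dim M = n` for some natural number `n`. -/
def HasFiniteGoldieDim : Prop :=
  ∃ n : ℕ, HasGoldieDim S M n

/-- The socle of `M`: the sum of all simple submodules of `M`. -/
def moduleSocle : Submodule S M :=
  sSup {N : Submodule S M | IsSimpleModule S N}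

end ModuleNotions

section RingNotions

/-! A right `R`-module is a module over `Rᵐᵒᵖ`; the right module `R_R` is `R` with its standard
`Rᵐᵒᵖ`-module structure `MulOpposite.op r • x = x * r`. -/

variable (R : Type*) [Ring R]

/-- `R` is semilocal: the quotient of `R` by its Jacobson radical is a semisimple ring. -/
def IsSemilocalRing : Prop :=
  IsSemisimpleRing (R ⧸ Ring.jacobson R)

/-- `R` is right finite dimensional: `R_R` has finite Goldie dimension. -/
def IsRightFiniteDimensional : Prop :=
  HasFiniteGoldieDim Rᵐᵒᵖ R

/-- `R` is right self-injective: `R_R` is an injective right `R`-module. -/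
def IsRightSelfInjective : Prop :=
  Module.Injective Rᵐᵒᵖ R

/-- The socle of `R_R` is essential in `R_R`. -/
def HasEssentialRightSocle : Prop :=
  IsEssentialSubmodule (moduleSocle Rᵐᵒᵖ R)

/-- `R` is right PF: semilocal and right self-injective, with an essential right socle. -/
def IsRightPF : Prop :=
  IsSemilocalRing R ∧ IsRightSelfInjective R ∧ HasEssentialRightSocle R

end RingNotions

section ModuleLemmas

variable {A : Type*} [Ring A] {M N : Type*} [AddCommGroup M] [Module A M]
  [AddCommGroup N] [Module A N]

/-! Let `S` be the right socle of a right self-injective ring `R`, and assume `S` is essential. Left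
multiplication gives a ring map `R → End(S)`: it is onto because endomorphisms of `S` extend to `R`,
and its kernel is the Jacobson radical, so `R/J ≅ End(S)`. As `S` is semisimple, `End(S)` is
semisimple exactly when `S` is noetherian. As `S` is essential, this in turn is equivalent to finite
Goldie dimension. -/

theorem IsSimpleModule.map_le_moduleSocle (f : M →ₗ[A] N) (T : Submodule A M)
    [IsSimpleModule A T] : T.map f ≤ moduleSocle A N := by
  have hrange : LinearMap.range (f.domRestrict T) = T.map f := by
    rw [LinearMap.domRestrict, LinearMap.range_comp, Submodule.range_subtype]
  rcases LinearMap.injective_or_eq_zero (f.domRestrict T) with h | h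
  · refine le_sSup ?_
    have e := LinearEquiv.ofInjective _ h
    have : IsSimpleModule A (LinearMap.range (f.domRestrict T)) := IsSimpleModule.congr e.symm
    rwa [hrange] at this
  · rw [← hrange, h, LinearMap.range_zero]
    exact bot_le

theorem moduleSocle_le_comap (f : M →ₗ[A] N) :
    moduleSocle A M ≤ (moduleSocle A N).comap f := by
  refine sSup_le fun T hT => ?_
  have : IsSimpleModule A T := hT
  exact Submodule.map_le_iff_le_comap.mp (IsSimpleModule.map_le_moduleSocle f T)

instance isSemisimpleModule_moduleSocle : IsSemisimpleModule A (moduleSocle A M) := by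
  rw [moduleSocle, sSup_eq_iSup]
  refine isSemisimpleModule_biSup_of_isSemisimpleModule_submodule fun T hT => ?_
  have : IsSimpleModule A T := hT
  infer_instance

theorem moduleSocle_le_of_isEssentialSubmodule {V : Submodule A M} (hV : IsEssentialSubmodule V) :
    moduleSocle A M ≤ V := by
  refine sSup_le fun T hT => ?_
  have hT' : IsAtom T := isSimpleModule_iff_isAtom.mp hT
  by_contra hTV
  exact hT'.1 (hV T (hT'.not_le_iff_disjoint.mp hTV).symm.eq_bot)

/-- In fact `T` is zero or simple: a complement of a simple submodule meets it trivially, so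
uniformity makes the complement zero. -/
theorem IsUniformModule.isNoetherian_of_isSemisimpleModule (hM : IsUniformModule A M)
    (T : Submodule A M) [IsSemisimpleModule A T] : IsNoetherian A T := by
  by_cases hT : T = ⊥
  · subst hT
    infer_instance
  have : Nontrivial T := T.nontrivial_iff_ne_bot.mpr hT
  obtain ⟨L, hL⟩ := IsSemisimpleModule.exists_simple_submodule A T
  obtain ⟨C, hC⟩ := exists_isCompl L
  have hmap (X : Submodule A T) : X.map T.subtype = ⊥ ↔ X = ⊥ :=
    (Submodule.map_injective_of_injective T.injective_subtype).eq_iff' (Submodule.map_bot _)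
  have hL0 : L.map T.subtype ≠ ⊥ := by
    rw [Ne, hmap]
    exact (isSimpleModule_iff_isAtom.mp hL).1
  have hC0 : C.map T.subtype = ⊥ := by
    apply hM.2 _ hL0
    rw [← Submodule.map_inf _ T.injective_subtype, hC.inf_eq_bot, Submodule.map_bot]
  rw [hmap] at hC0
  have hLtop : L = ⊤ := by simpa [hC0] using hC.sup_eq_top
  have : IsNoetherian A (⊤ : Submodule A T) := hLtop ▸ inferInstance
  exact isNoetherian_of_linearEquiv Submodule.topEquiv

/-- The socle lies in every essential submodule, hence embeds in the finite sum of the `U i`; its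
projection to each `U i` is a semisimple submodule of a uniform module. -/
theorem HasFiniteGoldieDim.isNoetherian_moduleSocle (h : HasFiniteGoldieDim A M) :
    IsNoetherian A (moduleSocle A M) := by
  obtain ⟨n, U, hU, hind, hess⟩ := h
  have hle : moduleSocle A M ≤ LinearMap.range (DFinsupp.lsum ℕ fun i => (U i).subtype) := by
    rw [← Submodule.iSup_eq_range_dfinsupp_lsum]
    exact moduleSocle_le_of_isEssentialSubmodule hess
  let e := LinearEquiv.ofInjective _ hind.dfinsupp_lsum_injective
  let g : moduleSocle A M →ₗ[A] Π₀ i, U i := e.symm.toLinearMap ∘ₗ Submodule.inclusion hle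
  have hg : Function.Injective g := e.symm.injective.comp (Submodule.inclusion_injective hle)
  let c (i : Fin n) : moduleSocle A M →ₗ[A] U i := DFinsupp.lapply i ∘ₗ g
  have hc (i : Fin n) : IsNoetherian A (LinearMap.range (c i)) := by
    have := IsSemisimpleModule.range (c i)
    exact (hU i).isNoetherian_of_isSemisimpleModule _
  refine isNoetherian_of_injective (LinearMap.pi fun i => (c i).rangeRestrict) fun x y hxy => ?_
  exact hg (DFinsupp.ext fun i => congrArg Subtype.val (congrFun hxy i))

theorem IsSimpleModule.isUniformModule [IsSimpleModule A M] : IsUniformModule A M := by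
  refine ⟨IsSimpleModule.nontrivial A M, fun L hL K hK => ?_⟩
  rwa [(eq_bot_or_eq_top L).resolve_left hL, top_inf_eq] at hK

theorem hasFiniteGoldieDim_of_isNoetherian_moduleSocle [IsNoetherian A (moduleSocle A M)]
    (hess : IsEssentialSubmodule (moduleSocle A M)) : HasFiniteGoldieDim A M := by
  obtain ⟨s, hind, htop, hs⟩ :=
    IsSemisimpleModule.exists_sSupIndep_sSup_simples_eq_top A (moduleSocle A M)
  rw [sSupIndep_iff] at hind
  have : Finite s := WellFoundedGT.finite_of_iSupIndep hind
    fun L => (isSimpleModule_iff_isAtom.mp (hs L.1 L.2)).1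
  let e := (Finite.equivFin s).symm
  have hinj := (moduleSocle A M).injective_subtype
  refine ⟨Nat.card s, fun i => (e i).1.map (moduleSocle A M).subtype, fun i => ?_, ?_, ?_⟩
  · have := hs _ (e i).2
    have := IsSimpleModule.congr ((e i).1.equivMapOfInjective _ hinj).symm
    exact IsSimpleModule.isUniformModule
  · exact LinearMap.iSupIndep_map _ hinj (hind.comp e.injective)
  · rw [← Submodule.map_iSup, e.iSup_comp (g := fun L : s => L.1), ← sSup_eq_iSup', htop,
      Submodule.map_top, Submodule.range_subtype]
    exact hess

/-- A semisimple module with semisimple endomorphism ring is noetherian: sending a submodule to the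
left ideal of endomorphisms that vanish on it is strictly antitone. -/
theorem IsSemisimpleModule.isNoetherian_of_isSemisimpleRing_end [IsSemisimpleModule A M]
    [IsSemisimpleRing (Module.End A M)] : IsNoetherian A M := by
  have : IsArtinianRing (Module.End A M) := inferInstance
  let φ (L : Submodule A M) : Ideal (Module.End A M) :=
    { carrier := {f | L ≤ LinearMap.ker f}
      add_mem' := fun {f g} hf hg x hx => by
        have h1 : f x = 0 := hf hx
        have h2 : g x = 0 := hg hx
        simp [h1, h2]
      zero_mem' := by simp
      smul_mem' := fun f g hg x hx => by
        have h : g x = 0 := hg hx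
        simp [h] }
  have hle {L K : Submodule A M} (h : φ K ≤ φ L) : L ≤ K := by
    obtain ⟨C, hC⟩ := exists_isCompl K
    -- The projection onto `C` along `K` has kernel exactly `K`, so `φ K` determines `K`.
    have hK : C.projection K hC.symm ∈ φ K := by
      change K ≤ LinearMap.ker _
      simp
    have hL : L ≤ LinearMap.ker (C.projection K hC.symm) := h hK
    simpa using hL
  have hanti : StrictAnti φ := fun L K hLK =>
    lt_of_le_not_ge (fun f hf => hLK.le.trans hf) fun h => hLK.not_ge (hle h)
  exact isNoetherian_mk hanti.wellFoundedGT

variable (A M) in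
/-- Restriction of endomorphisms of a module to its socle. -/
def endRestrictSocle : Module.End A M →+* Module.End A (moduleSocle A M) where
  toFun f := f.restrict (moduleSocle_le_comap f)
  map_one' := rfl
  map_mul' _ _ := rfl
  map_zero' := rfl
  map_add' _ _ := rfl

end ModuleLemmas

section RingLemmas

variable (R : Type*) [Ring R]

/-- The action of a ring by left multiplication on its right socle. -/
def rightSocleAction : R →+* Module.End Rᵐᵒᵖ (moduleSocle Rᵐᵒᵖ R) :=
  (endRestrictSocle Rᵐᵒᵖ R).comp (Module.toModuleEnd Rᵐᵒᵖ R)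

variable {R}

theorem rightSocleAction_apply (a : R) (x : moduleSocle Rᵐᵒᵖ R) :
    (rightSocleAction R a x : R) = a * x := rfl

theorem IsRightSelfInjective.exists_mul_eq (hR : IsRightSelfInjective R) {I : Submodule Rᵐᵒᵖ R}
    (g : I →ₗ[Rᵐᵒᵖ] R) : ∃ b : R, ∀ x : I, g x = b * x := by
  obtain ⟨h, hh⟩ := Module.Injective.out (self := hR) I.subtype I.injective_subtype g
  refine ⟨h 1, fun x => ?_⟩
  rw [← hh x]
  simpa using h.map_smul (MulOpposite.op (x : R)) 1

/-- An element of a right self-injective ring that is left cancellable on a right ideal has a left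
inverse on it. -/
theorem IsRightSelfInjective.exists_mul_mul_eq (hR : IsRightSelfInjective R)
    {I : Submodule Rᵐᵒᵖ R} {a : R} (ha : ∀ x ∈ I, a * x = 0 → x = 0) :
    ∃ b : R, ∀ x ∈ I, b * (a * x) = x := by
  let f : I →ₗ[Rᵐᵒᵖ] R := (Module.toModuleEnd Rᵐᵒᵖ R a).domRestrict I
  have hf : Function.Injective f :=
    (injective_iff_map_eq_zero f).mpr fun x hx => Subtype.ext (ha x x.2 hx)
  obtain ⟨h, hh⟩ := Module.Injective.out (self := hR) f hf I.subtype
  refine ⟨h 1, fun x hx => ?_⟩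
  have h1 : h (a * x) = x := hh ⟨x, hx⟩
  have h2 : h (a * x) = h 1 * (a * x) := by
    simpa using h.map_smul (MulOpposite.op (a * x)) 1
  rw [← h2, h1]

theorem IsRightSelfInjective.rightSocleAction_surjective (hR : IsRightSelfInjective R) :
    Function.Surjective (rightSocleAction R) := fun f => by
  obtain ⟨b, hb⟩ := hR.exists_mul_eq ((moduleSocle Rᵐᵒᵖ R).subtype ∘ₗ f)
  exact ⟨b, LinearMap.ext fun x => Subtype.ext (hb x).symm⟩

theorem IsRightSelfInjective.rightSocleAction_eq_zero (hR : IsRightSelfInjective R)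
    {a : R} (ha : a ∈ Ring.jacobson R) : rightSocleAction R a = 0 := by
  suffices h : moduleSocle Rᵐᵒᵖ R ≤ LinearMap.ker (Module.toModuleEnd Rᵐᵒᵖ R a) from
    LinearMap.ext fun x => Subtype.ext (h x.2)
  refine sSup_le fun T hT => ?_
  have : IsSimpleModule Rᵐᵒᵖ T := hT
  let f : T →ₗ[Rᵐᵒᵖ] R := (Module.toModuleEnd Rᵐᵒᵖ R a).domRestrict T
  rcases LinearMap.injective_or_eq_zero f with hf | hf
  · obtain ⟨b, hb⟩ := hR.exists_mul_mul_eq (I := T) (a := a) fun x hx h0 =>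
      congrArg Subtype.val ((injective_iff_map_eq_zero f).mp hf ⟨x, hx⟩ h0)
    rw [← Ideal.jacobson_bot, Ideal.mem_jacobson_iff] at ha
    -- With `-b`, `z` is a left inverse of `1 - b * a`, which kills `T`; so `T` would be zero.
    obtain ⟨z, hz⟩ := ha (-b)
    rw [Ideal.mem_bot] at hz
    intro x hx
    have hx0 : x = 0 := by
      have h := congrArg (· * x) hz
      simp only [sub_mul, add_mul, zero_mul, one_mul, mul_assoc, neg_mul, mul_neg, hb x hx] at h
      simpa using h
    simp [hx0]
  · exact fun x hx => LinearMap.congr_fun hf ⟨x, hx⟩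

/-- Each `y * a + 1` acts as the identity on the socle, so its right annihilator misses the socle
and vanishes by essentiality; self-injectivity then supplies a left inverse. -/
theorem mem_jacobson_of_rightSocleAction_eq_zero (hR : IsRightSelfInjective R)
    (hess : HasEssentialRightSocle R) {a : R} (ha : rightSocleAction R a = 0) :
    a ∈ Ring.jacobson R := by
  rw [← Ideal.jacobson_bot, Ideal.mem_jacobson_iff]
  intro y
  have hann (x : R) (hx : x ∈ moduleSocle Rᵐᵒᵖ R) : a * x = 0 :=
    congrArg Subtype.val (LinearMap.congr_fun ha ⟨x, hx⟩)
  have hker : LinearMap.ker (Module.toModuleEnd Rᵐᵒᵖ R (y * a + 1)) = ⊥ := by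
    refine hess _ (eq_bot_iff.mpr fun x hx => ?_)
    have h : (y * a + 1) * x = 0 := hx.2
    simpa [add_mul, mul_assoc, hann x hx.1] using h
  obtain ⟨z, hz⟩ := hR.exists_mul_mul_eq (I := ⊤) (a := y * a + 1) fun x _ h0 =>
    by
      have hx : x ∈ LinearMap.ker (Module.toModuleEnd Rᵐᵒᵖ R (y * a + 1)) := h0
      rwa [hker] at hx
  refine ⟨z, ?_⟩
  have h := hz 1 trivial
  rw [mul_one, mul_add, mul_one, ← mul_assoc] at h
  rw [Ideal.mem_bot, h, sub_self]

theorem isSemilocalRing_iff_isNoetherian_moduleSocle (hR : IsRightSelfInjective R)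
    (hess : HasEssentialRightSocle R) :
    IsSemilocalRing R ↔ IsNoetherian Rᵐᵒᵖ (moduleSocle Rᵐᵒᵖ R) := by
  let φ := Ideal.Quotient.lift (Ring.jacobson R) (rightSocleAction R)
    fun _ ha => hR.rightSocleAction_eq_zero ha
  have hφ : Function.Bijective φ := by
    refine ⟨(injective_iff_map_eq_zero φ).mpr fun x hx => ?_,
      Ideal.Quotient.lift_surjective_of_surjective _ _ hR.rightSocleAction_surjective⟩
    obtain ⟨a, rfl⟩ := Ideal.Quotient.mk_surjective x
    exact Ideal.Quotient.eq_zero_iff_mem.mpr (mem_jacobson_of_rightSocleAction_eq_zero hR hess hx)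
  rw [IsSemilocalRing, (RingEquiv.ofBijective φ hφ).isSemisimpleRing_iff]
  refine ⟨fun _ => IsSemisimpleModule.isNoetherian_of_isSemisimpleRing_end, fun _ => ?_⟩
  exact IsSemisimpleRing.moduleEnd _ _

end RingLemmas

theorem corollary3p7 (R : Type*) [Ring R] :
    IsRightPF R ↔
      IsRightFiniteDimensional R ∧ IsRightSelfInjective R ∧ HasEssentialRightSocle R := by
  refine and_congr_left fun ⟨hR, hess⟩ => ?_
  rw [isSemilocalRing_iff_isNoetherian_moduleSocle hR hess]
  exact ⟨fun _ => hasFiniteGoldieDim_of_isNoetherian_moduleSocle hess,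
    HasFiniteGoldieDim.isNoetherian_moduleSocle⟩
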